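/- **Theorem.** The category of left restriction semigroupoids and premorphisms is isomorphic to the category of li-constellations and inductive preradiants. More precisely, the assignments $S\mapsto C(S)$, $\varphi\mapsto\varphi$ and $T\mapsto G(T)$, $\varphi\mapsto\varphi$ described below are well-defined functors between these categories, and $G\circ C=\mathrm{id}$ and $C\circ G=\mathrm{id}$ (equality on objects and on morphisms). **Left restriction semigroupoids.** A *semigroupoid* is a set $S$ with a partial binary operation, such that whenever $st,tr$ are defined, or $st,(st)r$ are defined, or $tr,s(tr)$ are defined, all of $st,tr,(st)r,s(tr)$ are defined and $(st)r=s(tr)$. A *left restriction semigroupoid* is a semigroupoid $S$ with a map $s\mapsto s^+$ such that: (1) $s^+s$ is defined and equals $s$; (2) $s^+t^+$ is defined iff $t^+s^+$ is defined, and then they are equal; (3) if $s^+t$ is defined, then $(s^+t)^+=s^+t^+$; (4) if $st$ is defined, then $st^+=(st)^+s$ (the products on the right in (3) and on both sides in (4) being then defined). Its natural partial order is: $s\le t$ iff $s^+t$ is defined and $s=s^+t$. A *premorphism* $\varphi:S\to S'$ is a function such that (i) if $st$ is defined, then $\varphi(s)\varphi(t)$ and $\varphi(s)^+\varphi(st)$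 are defined and equal, and (ii) $\varphi(s)^+\le\varphi(s^+)$ for all $s$. **li-constellations.** A *left constellation* is a set $T$ with a partial binary operation and a map $x\mapsto x^+$ such that, with $T^+=\{x^+:x\in T\}$: (c1) $xy$ and $yz$ are defined iff $yz$ and $x(yz)$ are defined; (c2) if $xy,yz$ are defined, then $(xy)z$ is defined and $x(yz)=(xy)z$; (c3) for $e\in T^+$, $ex$ is defined and equals $x$ iff $e=x^+$; (c4) if $e\in T^+$ and $xe$ is defined, then $xe=x$. An *li-constellation* (locally inductive left constellation) is a left constellation $T$ with a partial order $\le$ such that, for all $x,y,x',y'\in T$ and $e,f\in T^+$: 1. if $x\le y$, $x'\le y'$ and $xx'$, $yy'$ are defined, then $xx'\le yy'$; 2. if $x\le y$, then $x^+\le y^+$; 3. if $e\le x^+$, there is a unique element $e|x\in T$ (the *restriction*) with $e|x\le x$ and $(e|x)^+=e$; 4. the set $\{y\in T: y\le x,\ ye\text{ is defined}\}$ is either empty or has a maximum element, which is then denoted $x|e$ (the *corestriction*); we write $x|e\ne\emptyset$ if it exists; 5. if $xy$ is defined, then $(xy)|e\neq\emptyset$ iff $y|e\ne\emptyset$; 6.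 if $f\le e$, then $x|e\ne\emptyset$ iff $x|f\neq\emptyset$; 7. if $xy$ is defined and $(xy)|e\ne\emptyset$, then $((xy)|e)^+=(x|(y|e)^+)^+$; 8. if $e\le f$, then the restriction $e|f$ and the corestriction $e|f$ coincide; 9. each connected component of the partially ordered set $T^+$ (class of the equivalence relation generated by $\le$ on $T^+$) is a meet-semilattice, and the corestriction is its meet operation: for $e,f\in T^+$, the corestriction $e|f$ exists iff $e,f$ lie in the same component, and then $e|f=e\wedge f$. The *pseudo-product* of $T$ is the partial operation $x\otimes y=(x|y^+)y$, defined iff $x|y^+\ne\emptyset$. An *inductive preradiant* $\varphi:T\to L$ of li-constellations is a function such that, for $x,y\in T$ and $e\in T^+$: (i) if $xy$ is defined, then $\varphi(x)\otimes\varphi(y)$ and $\varphi(x)^+\otimes\varphi(xy)$ are defined and equal; (ii) $\varphi(x)^+\le\varphi(x^+)$; (iii) if $x\le y$, then $\varphi(x)\le\varphi(y)$; (iv) if $x|e\ne\emptyset$, then $\varphi(x)|\varphi(e)\neq\emptyset$ and $\varphi(x|e)=\varphi(x)|\varphi(e)$; (v) if $e\le x^+$, then $\varphi(e|x)^+=\varphi(e)|\varphi(x)^+$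 (restriction on the left, corestriction on the right, the latter being defined). In both categories, composition is the composition of functions. **The functors.** For a left restriction semigroupoid $S$, $C(S)$ is the set $S$ with the same map $^+$, the natural partial order, and the operation $s\bullet t$, which is defined iff $st^+$ is defined and equals $s$, and then $s\bullet t=st$. For an li-constellation $T$, $G(T)$ is the set $T$ with the same map $^+$ and the operation $\otimes$. On morphisms, $C\varphi=\varphi$ and $G\varphi=\varphi$ as functions. -/

import Mathlib

open CategoryTheory

universe u

/-! ## Left restriction semigroupoids

A partial binary operation on `X` is a function `mul : X → X → Part X`: the set of composable
pairs is `{(x, y) | (mul x y).Dom}`, and `z ∈ mul x y` says that `xy` is defined and equals `z`. -/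

/-- A semigroupoid in the sense of Exel: a set with a partial operation such that, as soon as
`st, tr` are defined, or `st, (st)r` are defined, or `tr, s(tr)` are defined, all four products are
defined and `(st)r = s(tr)`. -/
structure Semigroupoid where
  carrier : Type u
  mul : carrier → carrier → Part carrier
  assoc : ∀ s t r : carrier,
    ((mul s t).Dom ∧ (mul t r).Dom) ∨
      (∃ a ∈ mul s t, (mul a r).Dom) ∨
      (∃ b ∈ mul t r, (mul s b).Dom) →
    ∃ a ∈ mul s t, ∃ b ∈ mul t r, ∃ w, w ∈ mul a r ∧ w ∈ mul s b

/-- A left restriction semigroupoid. -/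
structure LeftRestrictionSemigroupoid extends Semigroupoid.{u} where
  plus : carrier → carrier
  /-- `s⁺s` is defined and equals `s`. -/
  lr1 : ∀ s, s ∈ mul (plus s) s
  /-- `s⁺t⁺` is defined iff `t⁺s⁺` is, and then they are equal. -/
  lr2 : ∀ s t, mul (plus s) (plus t) = mul (plus t) (plus s)
  /-- If `s⁺t` is defined, then `(s⁺t)⁺ = s⁺t⁺`. -/
  lr3 : ∀ s t, ∀ a ∈ mul (plus s) t, plus a ∈ mul (plus s) (plus t)
  /-- If `st` is defined, then `st⁺ = (st)⁺s`. -/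
  lr4 : ∀ s t, ∀ a ∈ mul s t, ∃ w, w ∈ mul s (plus t) ∧ w ∈ mul (plus a) s

namespace LeftRestrictionSemigroupoid

/-- The natural partial order: `s ≤ t` iff `s⁺t` is defined and `s⁺t = s`. -/
def le (S : LeftRestrictionSemigroupoid.{u}) (s t : S.carrier) : Prop :=
  s ∈ S.mul (S.plus s) t

end LeftRestrictionSemigroupoid

/-- A premorphism of left restriction semigroupoids. -/
structure IsPremorphism (S S' : LeftRestrictionSemigroupoid.{u}) (φ : S.carrier → S'.carrier) :
    Prop where
  /-- If `st` is defined, then `φ(s)φ(t)` and `φ(s)⁺φ(st)` are defined and equal. -/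
  pm1 : ∀ s t, ∀ a ∈ S.mul s t,
    ∃ w, w ∈ S'.mul (φ s) (φ t) ∧ w ∈ S'.mul (S'.plus (φ s)) (φ a)
  /-- `φ(s)⁺ ≤ φ(s⁺)`. -/
  pm2 : ∀ s, S'.le (S'.plus (φ s)) (φ (S.plus s))

/-! ## Locally inductive left constellations -/

/-- A left constellation. -/
structure LeftConstellation where
  carrier : Type u
  mul : carrier → carrier → Part carrier
  plus : carrier → carrier
  /-- `xy, yz` are defined iff `yz, x(yz)` are defined. -/
  c1 : ∀ x y z, ((mul x y).Dom ∧ (mul y z).Dom) ↔ ∃ b ∈ mul y z, (mul x b).Dom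
  /-- If `xy, yz` are defined, then `(xy)z` is defined and `x(yz) = (xy)z`. -/
  c2 : ∀ x y z, (mul x y).Dom → (mul y z).Dom →
    ∃ a ∈ mul x y, ∃ b ∈ mul y z, ∃ w, w ∈ mul x b ∧ w ∈ mul a z
  /-- For `e ∈ T⁺`: `ex` is defined and equals `x` iff `e = x⁺`. -/
  c3 : ∀ e ∈ Set.range plus, ∀ x, x ∈ mul e x ↔ e = plus x
  /-- For `e ∈ T⁺`: if `xe` is defined, then `xe = x`. -/
  c4 : ∀ e ∈ Set.range plus, ∀ x, (mul x e).Dom → x ∈ mul x e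

/-- A left constellation together with a partial order on its underlying set. -/
structure PosetConstellation extends LeftConstellation.{u} where
  le : carrier → carrier → Prop
  le_refl : ∀ x, le x x
  le_trans : ∀ x y z, le x y → le y z → le x z
  le_antisymm : ∀ x y, le x y → le y x → x = y

namespace PosetConstellation

variable (T : PosetConstellation.{u})

/-- The set `T⁺ = {x⁺ : x ∈ T}`. -/
def proj : Set T.carrier := Set.range T.plus

/-- `r` is a restriction of `x` to `e`: `r ≤ x` and `r⁺ = e`. -/
def IsRestriction (e x r : T.carrier) : Prop := T.le r x ∧ T.plus r = e

/-- `m` is the maximum of the set `{y : y ≤ x and ye is defined}`. -/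
def IsCorestriction (x e m : T.carrier) : Prop :=
  (T.le m x ∧ (T.mul m e).Dom) ∧ ∀ y, T.le y x → (T.mul y e).Dom → T.le y m

/-- The corestriction `x|e`, as a partial element: the maximum of `{y : y ≤ x and ye is defined}`.
`(T.corestr x e).Dom` expresses `x|e ≠ ∅`. -/
noncomputable def corestr (x e : T.carrier) : Part T.carrier :=
  ⟨∃ m, T.IsCorestriction x e m, fun h => h.choose⟩

/-- The connected component of `e` in the partially ordered set `T⁺`. -/
def component (e : T.carrier) : Set T.carrier :=
  {f | f ∈ T.proj ∧
    Relation.EqvGen (fun a b => a ∈ T.proj ∧ b ∈ T.proj ∧ T.le a b) e f}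

/-- `m` is the meet of `e` and `f` in the subset `X`. -/
def IsMeetIn (X : Set T.carrier) (e f m : T.carrier) : Prop :=
  m ∈ X ∧ T.le m e ∧ T.le m f ∧ ∀ z ∈ X, T.le z e → T.le z f → T.le z m

/-- The pseudo-product `x ⊗ y = (x|y⁺)y`, as a partial operation. -/
noncomputable def pseudo (x y : T.carrier) : Part T.carrier :=
  (T.corestr x (T.plus y)).bind fun m => T.mul m y

variable {T}

theorem mem_corestr {x e m : T.carrier} : m ∈ T.corestr x e ↔ T.IsCorestriction x e m := by
  constructor
  · rintro ⟨h, rfl⟩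
    exact Exists.choose_spec h
  · intro h
    have hd : ∃ m, T.IsCorestriction x e m := ⟨m, h⟩
    have h2 := hd.choose_spec
    exact ⟨hd, T.le_antisymm _ _ (h.2 _ h2.1.1 h2.1.2) (h2.2 _ h.1.1 h.1.2)⟩

theorem mem_pseudo {x y z : T.carrier} :
    z ∈ T.pseudo x y ↔ ∃ m ∈ T.corestr x (T.plus y), z ∈ T.mul m y := by
  simp [pseudo]

end PosetConstellation

/-- A locally inductive left constellation (li-constellation). -/
structure LiConstellation extends PosetConstellation.{u} where
  wo1 : ∀ x y x' y', le x y → le x' y' → ∀ a ∈ mul x x', ∀ b ∈ mul y y', le a b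
  wo2 : ∀ x y, le x y → le (plus x) (plus y)
  wo3 : ∀ e ∈ toPosetConstellation.proj, ∀ x, le e (plus x) →
    ∃! r, toPosetConstellation.IsRestriction e x r
  wo4 : ∀ e ∈ toPosetConstellation.proj, ∀ x,
    (∃ y, le y x ∧ (mul y e).Dom) → (toPosetConstellation.corestr x e).Dom
  wo5 : ∀ e ∈ toPosetConstellation.proj, ∀ x y, ∀ a ∈ mul x y,
    ((toPosetConstellation.corestr a e).Dom ↔ (toPosetConstellation.corestr y e).Dom)
  wo6 : ∀ e ∈ toPosetConstellation.proj, ∀ f ∈ toPosetConstellation.proj, le f e → ∀ x,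
    ((toPosetConstellation.corestr x e).Dom ↔ (toPosetConstellation.corestr x f).Dom)
  /-- If `xy` and `(xy)|e` are defined, then `((xy)|e)⁺ = (x|(y|e)⁺)⁺`. -/
  wo7 : ∀ e ∈ toPosetConstellation.proj, ∀ x y, ∀ a ∈ mul x y,
    ∀ m ∈ toPosetConstellation.corestr a e,
      ∃ n ∈ toPosetConstellation.corestr y e,
        ∃ k ∈ toPosetConstellation.corestr x (plus n), plus m = plus k
  /-- If `e ≤ f` in `T⁺`, then the restriction `e|f` and the corestriction `e|f` coincide. -/
  wo8 : ∀ e ∈ toPosetConstellation.proj, ∀ f ∈ toPosetConstellation.proj, le e f →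
    ∃ m, toPosetConstellation.IsRestriction e f m ∧ m ∈ toPosetConstellation.corestr e f
  /-- Every connected component of `T⁺` is a meet-semilattice. -/
  wo9_meet : ∀ e ∈ toPosetConstellation.proj, ∀ f ∈ toPosetConstellation.component e,
    ∃ m, toPosetConstellation.IsMeetIn (toPosetConstellation.component e) e f m
  /-- The (partially defined) meet operation of `T⁺` is the corestriction. -/
  wo9_corestr : ∀ e ∈ toPosetConstellation.proj, ∀ f ∈ toPosetConstellation.proj, ∀ m,
    m ∈ toPosetConstellation.corestr e f ↔
      f ∈ toPosetConstellation.component e ∧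
        toPosetConstellation.IsMeetIn (toPosetConstellation.component e) e f m

/-- An inductive preradiant of li-constellations. -/
structure IsInductivePreradiant (T L : LiConstellation.{u}) (φ : T.carrier → L.carrier) :
    Prop where
  /-- If `xy` is defined, then `φ(x) ⊗ φ(y)` and `φ(x)⁺ ⊗ φ(xy)` are defined and equal. -/
  ip1 : ∀ x y, ∀ a ∈ T.mul x y,
    ∃ w, w ∈ L.pseudo (φ x) (φ y) ∧ w ∈ L.pseudo (L.plus (φ x)) (φ a)
  ip2 : ∀ x, L.le (L.plus (φ x)) (φ (T.plus x))
  ip3 : ∀ x y, T.le x y → L.le (φ x) (φ y)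
  /-- If `x|e ≠ ∅`, then `φ(x)|φ(e) ≠ ∅` and `φ(x|e) = φ(x)|φ(e)`. -/
  ip4 : ∀ x, ∀ e ∈ T.proj, ∀ m ∈ T.corestr x e, φ m ∈ L.corestr (φ x) (φ e)
  /-- If `e ≤ x⁺`, then `φ(e|x)⁺ = φ(e)|φ(x)⁺`, a restriction on the left-hand side and a
  corestriction on the right-hand side. -/
  ip5 : ∀ x, ∀ e ∈ T.proj, T.le e (T.plus x) → ∀ r, T.IsRestriction e x r →
    L.plus (φ r) ∈ L.corestr (φ e) (L.plus (φ x))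

/-! ## Basic facts on left restriction semigroupoids -/

namespace LeftRestrictionSemigroupoid

variable {S : LeftRestrictionSemigroupoid.{u}}

theorem assoc1 {s t r a b : S.carrier} (ha : a ∈ S.mul s t) (hb : b ∈ S.mul t r) :
    ∃ w, w ∈ S.mul a r ∧ w ∈ S.mul s b := by
  obtain ⟨a', ha', b', hb', w, h1, h2⟩ :=
    S.assoc s t r (Or.inl ⟨Part.dom_iff_mem.2 ⟨a, ha⟩, Part.dom_iff_mem.2 ⟨b, hb⟩⟩)
  rw [Part.mem_unique ha ha', Part.mem_unique hb hb']
  exact ⟨w, h1, h2⟩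

theorem assoc2 {s t r a w : S.carrier} (ha : a ∈ S.mul s t) (hw : w ∈ S.mul a r) :
    ∃ b ∈ S.mul t r, w ∈ S.mul s b := by
  obtain ⟨a', ha', b', hb', w', h1, h2⟩ :=
    S.assoc s t r (Or.inr (Or.inl ⟨a, ha, Part.dom_iff_mem.2 ⟨w, hw⟩⟩))
  rw [← Part.mem_unique ha ha'] at h1
  rw [Part.mem_unique hw h1]
  exact ⟨b', hb', h2⟩

theorem assoc3 {s t r b w : S.carrier} (hb : b ∈ S.mul t r) (hw : w ∈ S.mul s b) :
    ∃ a ∈ S.mul s t, w ∈ S.mul a r := by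
  obtain ⟨a', ha', b', hb', w', h1, h2⟩ :=
    S.assoc s t r (Or.inr (Or.inr ⟨b, hb, Part.dom_iff_mem.2 ⟨w, hw⟩⟩))
  rw [← Part.mem_unique hb hb'] at h2
  rw [Part.mem_unique hw h2]
  exact ⟨a', ha', h1⟩

theorem plus_mul_self (s : S.carrier) : S.plus s ∈ S.mul (S.plus s) (S.plus s) :=
  S.lr3 s s s (S.lr1 s)

theorem plus_plus (s : S.carrier) : S.plus (S.plus s) = S.plus s := by
  have h1 : S.plus s ∈ S.mul (S.plus (S.plus s)) (S.plus s) := S.lr1 _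
  have h2 := S.lr3 _ _ _ (plus_mul_self s)
  rw [S.lr2] at h2
  exact Part.mem_unique h2 h1

theorem dom_plus {s t a : S.carrier} (h : a ∈ S.mul s t) :
    ∃ b ∈ S.mul s (S.plus t), a ∈ S.mul b t :=
  assoc3 (S.lr1 t) h

theorem mul_of_dom_plus {s t b : S.carrier} (h : b ∈ S.mul s (S.plus t)) :
    ∃ a ∈ S.mul s t, a ∈ S.mul b t := by
  obtain ⟨w, h1, h2⟩ := assoc1 h (S.lr1 t)
  exact ⟨w, h2, h1⟩

theorem le_refl' (s : S.carrier) : S.le s s := S.lr1 s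

/-- If `a = s⁺t`, then `a ≤ t`. -/
theorem le_of_plus_mul {s t a : S.carrier} (h : a ∈ S.mul (S.plus s) t) : S.le a t := by
  have h1 := S.lr3 _ _ _ h
  obtain ⟨c, hc, hd⟩ := mul_of_dom_plus h1
  rw [Part.mem_unique h hc]
  rw [Part.mem_unique h hc] at hd
  exact hd

theorem plus_le_plus {s t : S.carrier} (h : S.le s t) :
    S.plus s ∈ S.mul (S.plus s) (S.plus t) := S.lr3 _ _ _ h

theorem le_plus_iff {e x : S.carrier} :
    S.le (S.plus e) (S.plus x) ↔ S.plus e ∈ S.mul (S.plus e) (S.plus x) := by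
  unfold le
  rw [plus_plus]

theorem plus_mono {s t : S.carrier} (h : S.le s t) : S.le (S.plus s) (S.plus t) :=
  le_plus_iff.2 (plus_le_plus h)

theorem le_trans' {s t r : S.carrier} (h1 : S.le s t) (h2 : S.le t r) : S.le s r := by
  obtain ⟨a, ha, hs⟩ := assoc3 h2 h1
  rw [← Part.mem_unique (plus_le_plus h1) ha] at hs
  exact hs

theorem le_antisymm' {s t : S.carrier} (h1 : S.le s t) (h2 : S.le t s) : s = t := by
  have h3 := plus_le_plus h1
  have h4 := plus_le_plus h2
  rw [S.lr2] at h4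
  have h5 := Part.mem_unique h3 h4
  unfold le at h1
  rw [h5] at h1
  exact Part.mem_unique h1 (S.lr1 t)

/-- `st ≤ s` when `t ∈ S⁺`. -/
theorem mul_plus_le {s t a : S.carrier} (h : a ∈ S.mul s (S.plus t)) : S.le a s := by
  obtain ⟨w, h1, h2⟩ := S.lr4 _ _ _ h
  rw [plus_plus] at h1
  rw [← Part.mem_unique h h1] at h2
  exact h2

/-- `(st⁺)⁺ = (st)⁺`. -/
theorem plus_mul_plus {s t a b : S.carrier} (ha : a ∈ S.mul s t)
    (hb : b ∈ S.mul s (S.plus t)) : S.plus b = S.plus a := by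
  obtain ⟨w, h1, h2⟩ := S.lr4 _ _ _ ha
  have hbw := Part.mem_unique hb h1
  subst hbw
  have h3 := S.lr3 _ _ _ h2
  have h4 : S.plus a ∈ S.mul (S.plus a) (S.plus s) := by
    obtain ⟨c, hc, hd⟩ := assoc3 ha (S.lr1 a)
    have h5 := Part.mem_unique hc h2
    subst h5
    obtain ⟨v, hv1, hv2⟩ := assoc1 (S.lr1 s) ha
    have h6 := Part.mem_unique hv1 ha
    subst h6
    have h7 := S.lr3 _ _ _ hv2
    rw [S.lr2] at h7
    exact h7
  exact Part.mem_unique h3 h4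

end LeftRestrictionSemigroupoid

namespace IsPremorphism

open LeftRestrictionSemigroupoid

variable {S S' S'' : LeftRestrictionSemigroupoid.{u}}

theorem map_plus {φ : S.carrier → S'.carrier} (h : IsPremorphism S S' φ) (s : S.carrier) :
    S'.plus (φ (S.plus s)) = φ (S.plus s) := by
  have h1 := h.pm2 (S.plus s)
  rw [plus_plus] at h1
  unfold le at h1
  rw [plus_plus] at h1
  exact Part.mem_unique h1 (S'.lr1 _)

/-- `φ(s)⁺ = φ(s)⁺φ(s⁺)`. -/
theorem plus_mem {φ : S.carrier → S'.carrier} (h : IsPremorphism S S' φ) (s : S.carrier) :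
    S'.plus (φ s) ∈ S'.mul (S'.plus (φ s)) (φ (S.plus s)) := by
  have h1 := h.pm2 s
  unfold le at h1
  rw [plus_plus] at h1
  exact h1

theorem mono {φ : S.carrier → S'.carrier} (h : IsPremorphism S S' φ) {s t : S.carrier}
    (hst : S.le s t) : S'.le (φ s) (φ t) := by
  obtain ⟨w, h1, h2⟩ := h.pm1 _ _ _ hst
  rw [h.map_plus] at h2
  -- `φ(s) = φ(s⁺)φ(s)`
  have h3 : φ s ∈ S'.mul (φ (S.plus s)) (φ s) := by
    have h4 := h.plus_mem s
    rw [← h.map_plus, S'.lr2] at h4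
    obtain ⟨c, hc, hd⟩ := assoc2 h4 (S'.lr1 (φ s))
    rw [← Part.mem_unique (S'.lr1 (φ s)) hc] at hd
    rw [← h.map_plus]
    exact hd
  rw [← Part.mem_unique h3 h2] at h1
  rw [← h.map_plus] at h1
  exact le_of_plus_mul h1

theorem id (S : LeftRestrictionSemigroupoid.{u}) : IsPremorphism S S _root_.id where
  pm1 s t a h := by
    obtain ⟨w, h1, h2⟩ := assoc1 (S.lr1 s) h
    have h3 := Part.mem_unique h1 h
    subst h3
    exact ⟨w, h1, h2⟩
  pm2 s := le_refl' _

theorem comp {φ : S.carrier → S'.carrier} {ψ : S'.carrier → S''.carrier}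
    (hφ : IsPremorphism S S' φ) (hψ : IsPremorphism S' S'' ψ) : IsPremorphism S S'' (ψ ∘ φ) where
  pm1 s t a h := by
    obtain ⟨b, hb1, hb2⟩ := hφ.pm1 _ _ _ h
    obtain ⟨w, hw1, hw2⟩ := hψ.pm1 _ _ _ hb1
    refine ⟨w, hw1, ?_⟩
    -- `w = ψ(φ s)⁺ ψ(b)` with `b = φ(s)⁺φ(a)`
    obtain ⟨v, hv1, hv2⟩ := hψ.pm1 _ _ _ hb2
    rw [hψ.map_plus] at hv2
    -- `ψ(φ s)⁺ = ψ(φ s)⁺ ψ(φ(s)⁺)`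
    have h1 := hψ.plus_mem (φ s)
    obtain ⟨x, hx1, hx2⟩ := assoc2 h1 hw2
    have h2 := Part.mem_unique hx1 hv2
    subst h2
    obtain ⟨y, hy1, hy2⟩ := assoc3 hv1 hx2
    rw [← Part.mem_unique h1 hy1] at hy2
    exact hy2
  pm2 s := le_trans' (hψ.pm2 _) (hψ.mono (hφ.pm2 s))

end IsPremorphism

/-- The category of left restriction semigroupoids and premorphisms, with the usual composition
of functions. -/
instance : Category LeftRestrictionSemigroupoid.{u} where
  Hom S S' := {φ : S.carrier → S'.carrier // IsPremorphism S S' φ}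
  id S := ⟨id, IsPremorphism.id S⟩
  comp φ ψ := ⟨ψ.1 ∘ φ.1, φ.2.comp ψ.2⟩

/-! ## Basic facts on li-constellations -/

namespace LiConstellation

open PosetConstellation

variable {T : LiConstellation.{u}}

theorem plus_mem_proj (x : T.carrier) : T.plus x ∈ T.proj := ⟨x, rfl⟩

theorem c2' {x y z a b : T.carrier} (ha : a ∈ T.mul x y) (hb : b ∈ T.mul y z) :
    ∃ w, w ∈ T.mul x b ∧ w ∈ T.mul a z := by
  obtain ⟨a', ha', b', hb', w, h1, h2⟩ :=
    T.c2 x y z (Part.dom_iff_mem.2 ⟨a, ha⟩) (Part.dom_iff_mem.2 ⟨b, hb⟩)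
  rw [Part.mem_unique ha ha', Part.mem_unique hb hb']
  exact ⟨w, h1, h2⟩

theorem plus_mul (x : T.carrier) : x ∈ T.mul (T.plus x) x :=
  (T.c3 _ ⟨x, rfl⟩ x).2 rfl

theorem plus_plus (x : T.carrier) : T.plus (T.plus x) = T.plus x := by
  obtain ⟨w, h1, h2⟩ := c2' (plus_mul (T.plus x)) (plus_mul x)
  have h3 := Part.mem_unique h2 (plus_mul x)
  subst h3
  exact (T.c3 _ ⟨_, rfl⟩ _).1 h1

theorem plus_of_proj {e : T.carrier} (he : e ∈ T.proj) : T.plus e = e := by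
  obtain ⟨x, rfl⟩ := he
  exact plus_plus x

theorem proj_mul {e : T.carrier} (he : e ∈ T.proj) : e ∈ T.mul e e := by
  have h := plus_mul e
  rwa [plus_of_proj he] at h

theorem plus_of_mul {x y a : T.carrier} (ha : a ∈ T.mul x y) : T.plus a = T.plus x := by
  obtain ⟨w, h1, h2⟩ := c2' (plus_mul x) ha
  have h3 := Part.mem_unique h2 ha
  subst h3
  exact ((T.c3 _ ⟨_, rfl⟩ _).1 h1).symm

theorem dom_iff {x y : T.carrier} : (T.mul x y).Dom ↔ (T.mul x (T.plus y)).Dom := by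
  have h := T.c1 x (T.plus y) y
  have h2 : (T.mul (T.plus y) y).Dom := Part.dom_iff_mem.2 ⟨y, plus_mul y⟩
  constructor
  · intro h3
    exact (h.2 ⟨y, plus_mul y, h3⟩).1
  · intro h3
    obtain ⟨b, hb, hd⟩ := h.1 ⟨h3, h2⟩
    rwa [Part.mem_unique hb (plus_mul y)] at hd

theorem eq_of_le {x y z : T.carrier} (hx : T.le x z) (hy : T.le y z)
    (h : T.plus x = T.plus y) : x = y :=
  (T.wo3 (T.plus x) ⟨x, rfl⟩ z (T.wo2 _ _ hx)).unique ⟨hx, rfl⟩ ⟨hy, h.symm⟩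

theorem proj_corestr {e f : T.carrier} (he : e ∈ T.proj) (hf : f ∈ T.proj) (h : T.le e f) :
    e ∈ T.corestr e f := by
  obtain ⟨m, h1, h2⟩ := T.wo8 e he f hf h
  have h3 : m = e := eq_of_le h1.1 h (by rw [h1.2, plus_of_proj he])
  rwa [h3] at h2

theorem proj_mul_of_le {e f : T.carrier} (he : e ∈ T.proj) (hf : f ∈ T.proj) (h : T.le e f) :
    e ∈ T.mul e f :=
  T.c4 f hf e (mem_corestr.1 (proj_corestr he hf h)).1.2

theorem exists_mul_of_le {e x : T.carrier} (he : e ∈ T.proj) (h : T.le e (T.plus x)) :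
    ∃ w ∈ T.mul e x, T.le w x ∧ T.plus w = e := by
  have h1 : (T.mul e x).Dom :=
    dom_iff.2 (Part.dom_iff_mem.2 ⟨e, proj_mul_of_le he ⟨_, rfl⟩ h⟩)
  obtain ⟨w, hw⟩ := Part.dom_iff_mem.1 h1
  refine ⟨w, hw, T.wo1 _ _ _ _ h (T.le_refl x) _ hw _ (plus_mul x), ?_⟩
  rw [plus_of_mul hw, plus_of_proj he]

theorem mem_mul_of_le {x y : T.carrier} (h : T.le x y) : x ∈ T.mul (T.plus x) y := by
  obtain ⟨w, hw, h1, h2⟩ := exists_mul_of_le ⟨x, rfl⟩ (T.wo2 _ _ h)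
  rwa [eq_of_le h1 h h2] at hw

theorem mem_proj_of_le {x e : T.carrier} (he : e ∈ T.proj) (h : T.le x e) : x ∈ T.proj := by
  have h1 := mem_mul_of_le h
  have h2 := T.c4 e he _ (Part.dom_iff_mem.2 ⟨_, h1⟩)
  exact ⟨x, Part.mem_unique h2 h1⟩

theorem corestr_self_of_mul {x y a : T.carrier} (ha : a ∈ T.mul x y) :
    x ∈ T.corestr x (T.plus y) :=
  mem_corestr.2 ⟨⟨T.le_refl x, dom_iff.1 (Part.dom_iff_mem.2 ⟨a, ha⟩)⟩, fun _ h _ => h⟩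

theorem corestr_trans {x e f m k : T.carrier} (he : e ∈ T.proj) (hf : f ∈ T.proj)
    (h : T.le e f) (hm : m ∈ T.corestr x f) (hk : k ∈ T.corestr x e) : k ∈ T.corestr m e := by
  rw [mem_corestr] at hm hk ⊢
  have h1 := T.c4 e he k hk.1.2
  obtain ⟨w, -, h2⟩ := c2' h1 (proj_mul_of_le he hf h)
  exact ⟨⟨hm.2 _ hk.1.1 (Part.dom_iff_mem.2 ⟨w, h2⟩), hk.1.2⟩,
    fun y hy hd => hk.2 y (T.le_trans _ _ _ hy hm.1.1) hd⟩

theorem corestr_mul {x y e a p n k : T.carrier} (he : e ∈ T.proj) (ha : a ∈ T.mul x y)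
    (hp : p ∈ T.corestr a e) (hn : n ∈ T.corestr y e) (hk : k ∈ T.corestr x (T.plus n)) :
    p ∈ T.mul k n := by
  obtain ⟨n', hn', k', hk', h1⟩ := T.wo7 e he x y a ha p hp
  rw [← Part.mem_unique hn hn'] at hk'
  rw [← Part.mem_unique hk hk'] at h1
  rw [mem_corestr] at hp hn hk
  obtain ⟨q, hq⟩ := Part.dom_iff_mem.1 (dom_iff.2 hk.1.2)
  have h2 := T.wo1 _ _ _ _ hk.1.1 hn.1.1 _ hq _ ha
  have h3 : q = p := eq_of_le h2 hp.1.1 (by rw [plus_of_mul hq, h1])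
  rwa [h3] at hq

/-- On `T⁺` the corestriction is the greatest lower bound. -/
theorem mem_corestr_proj {e f m : T.carrier} (he : e ∈ T.proj) (hf : f ∈ T.proj) :
    m ∈ T.corestr e f ↔
      m ∈ T.proj ∧ T.le m e ∧ T.le m f ∧
        ∀ z ∈ T.proj, T.le z e → T.le z f → T.le z m := by
  rw [T.wo9_corestr e he f hf]
  constructor
  · rintro ⟨-, h2, h3, h4, h5⟩
    exact ⟨h2.1, h3, h4, fun z hz h6 h7 =>
      h5 z ⟨hz, .symm _ _ (.rel _ _ ⟨hz, he, h6⟩)⟩ h6 h7⟩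
  · rintro ⟨h1, h2, h3, h4⟩
    have h5 : m ∈ T.component e := ⟨h1, .symm _ _ (.rel _ _ ⟨h1, he, h2⟩)⟩
    exact ⟨⟨hf, .trans _ _ _ h5.2 (.rel _ _ ⟨h1, hf, h3⟩)⟩, h5, h2, h3,
      fun z hz => h4 z hz.1⟩

theorem corestr_proj_comm {e f : T.carrier} (he : e ∈ T.proj) (hf : f ∈ T.proj) :
    T.corestr e f = T.corestr f e := by
  refine Part.ext fun m => ?_
  rw [mem_corestr_proj he hf, mem_corestr_proj hf he]
  constructor <;> rintro ⟨h1, h2, h3, h4⟩ <;>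
    exact ⟨h1, h3, h2, fun z hz h5 h6 => h4 z hz h6 h5⟩

/-- `x ⊗ y` is defined iff `x|y⁺ ≠ ∅`. -/
theorem pseudo_dom {x y : T.carrier} :
    (T.pseudo x y).Dom ↔ (T.corestr x (T.plus y)).Dom := by
  constructor
  · intro h
    obtain ⟨z, hz⟩ := Part.dom_iff_mem.1 h
    obtain ⟨m, hm, -⟩ := mem_pseudo.1 hz
    exact Part.dom_iff_mem.2 ⟨m, hm⟩
  · intro h
    obtain ⟨m, hm⟩ := Part.dom_iff_mem.1 h
    obtain ⟨z, hz⟩ := Part.dom_iff_mem.1 (dom_iff.2 (mem_corestr.1 hm).1.2)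
    exact Part.dom_iff_mem.2 ⟨z, mem_pseudo.2 ⟨m, hm, hz⟩⟩

theorem pseudo_proj {x e : T.carrier} (he : e ∈ T.proj) : T.pseudo x e = T.corestr x e := by
  refine Part.ext fun z => ?_
  rw [mem_pseudo, plus_of_proj he]
  constructor
  · rintro ⟨m, hm, hz⟩
    rwa [Part.mem_unique hz (T.c4 e he m (mem_corestr.1 hm).1.2)]
  · intro hz
    exact ⟨z, hz, T.c4 e he z (mem_corestr.1 hz).1.2⟩

theorem mem_pseudo_of_mul {x y a : T.carrier} (ha : a ∈ T.mul x y) : a ∈ T.pseudo x y :=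
  mem_pseudo.2 ⟨x, corestr_self_of_mul ha, ha⟩

theorem pseudo_assoc {x y z m n a b : T.carrier} (hm : m ∈ T.corestr x (T.plus y))
    (ha : a ∈ T.mul m y) (hn : n ∈ T.corestr y (T.plus z)) (hb : b ∈ T.mul n z) :
    ∃ w, w ∈ T.pseudo a z ∧ w ∈ T.pseudo x b := by
  have hbn := plus_of_mul hb
  have hle := T.wo2 _ _ (mem_corestr.1 hn).1.1
  have hk : (T.corestr x (T.plus n)).Dom :=
    (T.wo6 _ ⟨_, rfl⟩ _ ⟨_, rfl⟩ hle x).1 (Part.dom_iff_mem.2 ⟨m, hm⟩)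
  obtain ⟨k, hk⟩ := Part.dom_iff_mem.1 hk
  obtain ⟨p, hp⟩ := Part.dom_iff_mem.1
    ((T.wo5 _ ⟨_, rfl⟩ m y a ha).2 (Part.dom_iff_mem.2 ⟨n, hn⟩))
  have hpk := corestr_mul ⟨_, rfl⟩ ha hp hn (corestr_trans ⟨_, rfl⟩ ⟨_, rfl⟩ hle hm hk)
  obtain ⟨w, h1, h2⟩ := c2' hpk hb
  refine ⟨w, mem_pseudo.2 ⟨p, hp, h2⟩, mem_pseudo.2 ⟨k, ?_, h1⟩⟩
  rwa [hbn]

end LiConstellation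

/-- The left restriction semigroupoid `G(T)` of a li-constellation `T`: the same set and the same
map `⁺`, with the pseudo-product as operation. -/
noncomputable abbrev LiConstellation.toSemigroupoid (T : LiConstellation.{u}) :
    LeftRestrictionSemigroupoid.{u} where
  carrier := T.carrier
  mul := T.pseudo
  plus := T.plus
  assoc x y z h := by
    have key : (T.corestr x (T.plus y)).Dom ∧ (T.corestr y (T.plus z)).Dom := by
      rcases h with ⟨h1, h2⟩ | ⟨a, h1, h2⟩ | ⟨b, h1, h2⟩
      · exact ⟨LiConstellation.pseudo_dom.1 h1, LiConstellation.pseudo_dom.1 h2⟩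
      · obtain ⟨m, hm, ha⟩ := PosetConstellation.mem_pseudo.1 h1
        exact ⟨Part.dom_iff_mem.2 ⟨m, hm⟩,
          (T.wo5 _ ⟨_, rfl⟩ _ _ _ ha).1 (LiConstellation.pseudo_dom.1 h2)⟩
      · obtain ⟨n, hn, hb⟩ := PosetConstellation.mem_pseudo.1 h1
        have h3 := LiConstellation.pseudo_dom.1 h2
        rw [LiConstellation.plus_of_mul hb] at h3
        exact ⟨(T.wo6 _ ⟨_, rfl⟩ _ ⟨_, rfl⟩
          (T.wo2 _ _ (PosetConstellation.mem_corestr.1 hn).1.1) x).2 h3,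
          Part.dom_iff_mem.2 ⟨n, hn⟩⟩
    obtain ⟨a, ha⟩ := Part.dom_iff_mem.1 (LiConstellation.pseudo_dom.2 key.1)
    obtain ⟨b, hb⟩ := Part.dom_iff_mem.1 (LiConstellation.pseudo_dom.2 key.2)
    obtain ⟨m, hm, hma⟩ := PosetConstellation.mem_pseudo.1 ha
    obtain ⟨n, hn, hnb⟩ := PosetConstellation.mem_pseudo.1 hb
    exact ⟨a, ha, b, hb, LiConstellation.pseudo_assoc hm hma hn hnb⟩
  lr1 x := LiConstellation.mem_pseudo_of_mul (LiConstellation.plus_mul x)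
  lr2 x y := by
    rw [LiConstellation.pseudo_proj ⟨_, rfl⟩, LiConstellation.pseudo_proj ⟨_, rfl⟩,
      LiConstellation.corestr_proj_comm ⟨_, rfl⟩ ⟨_, rfl⟩]
  lr3 x y a ha := by
    obtain ⟨m, hm, hma⟩ := PosetConstellation.mem_pseudo.1 ha
    rw [LiConstellation.pseudo_proj ⟨_, rfl⟩, LiConstellation.plus_of_mul hma,
      LiConstellation.plus_of_proj
        (LiConstellation.mem_proj_of_le ⟨_, rfl⟩ (PosetConstellation.mem_corestr.1 hm).1.1)]
    exact hm
  lr4 x y a ha := by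
    obtain ⟨m, hm, hma⟩ := PosetConstellation.mem_pseudo.1 ha
    have hle := (PosetConstellation.mem_corestr.1 hm).1.1
    refine ⟨m, ?_, ?_⟩
    · rw [LiConstellation.pseudo_proj ⟨_, rfl⟩]
      exact hm
    · rw [LiConstellation.plus_of_mul hma]
      exact PosetConstellation.mem_pseudo.2 ⟨T.plus m,
        LiConstellation.proj_corestr ⟨_, rfl⟩ ⟨_, rfl⟩ (T.wo2 _ _ hle),
        LiConstellation.mem_mul_of_le hle⟩

theorem LiConstellation.le_of_toSemigroupoid_le {T : LiConstellation.{u}} {x y : T.carrier} :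
    T.toSemigroupoid.le x y ↔ T.le x y := by
  constructor
  · intro h
    obtain ⟨m, hm, hx⟩ := PosetConstellation.mem_pseudo.1 h
    have h1 := (mem_corestr_proj ⟨_, rfl⟩ ⟨_, rfl⟩).1 hm
    exact T.wo1 _ _ _ _ h1.2.2.1 (T.le_refl y) _ hx _ (plus_mul y)
  · intro h
    exact mem_pseudo_of_mul (mem_mul_of_le h)

namespace IsInductivePreradiant

open LiConstellation PosetConstellation

variable {T T' T'' : LiConstellation.{u}}

theorem map_proj {φ : T.carrier → T'.carrier} (h : IsInductivePreradiant T T' φ) {e : T.carrier}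
    (he : e ∈ T.proj) : φ e ∈ T'.proj := by
  have h1 := h.ip2 e
  rw [LiConstellation.plus_of_proj he] at h1
  have h2 := mem_mul_of_le h1
  rw [LiConstellation.plus_plus] at h2
  exact ⟨φ e, Part.mem_unique h2 (LiConstellation.plus_mul _)⟩

/-- An inductive preradiant satisfies the first axiom of a premorphism for the pseudo-products. -/
theorem isPremorphism {φ : T.carrier → T'.carrier} (h : IsInductivePreradiant T T' φ) :
    IsPremorphism T.toSemigroupoid T'.toSemigroupoid φ where
  pm1 s t a ha := by
    obtain ⟨u, hu, hua⟩ := mem_pseudo.1 ha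
    have hus := (mem_corestr.1 hu).1.1
    have hau := plus_of_mul hua
    -- `u = s|t⁺`, `a = ut`
    obtain ⟨w, hw1, hw2⟩ := h.ip1 _ _ _ hua
    refine ⟨w, ?_, ?_⟩
    · -- `φ(u) = φ(s)φ(t⁺)` and `φ(t⁺)φ(t) = φ(t)`
      have h1 := h.ip4 _ _ ⟨_, rfl⟩ _ hu
      have hp := h.map_proj (e := T.plus t) ⟨_, rfl⟩
      rw [← pseudo_proj hp] at h1
      have h2 : φ t ∈ T'.pseudo (φ (T.plus t)) (φ t) := by
        refine mem_pseudo.2 ⟨T'.plus (φ t), ?_, LiConstellation.plus_mul _⟩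
        rw [corestr_proj_comm hp ⟨_, rfl⟩]
        exact proj_corestr ⟨_, rfl⟩ hp (h.ip2 t)
      obtain ⟨b, hb, hwb⟩ := LeftRestrictionSemigroupoid.assoc2 (S := T'.toSemigroupoid) h1 hw1
      rw [← Part.mem_unique h2 hb] at hwb
      exact hwb
    · -- `φ(u)⁺ = φ(u⁺)φ(s)⁺` and `φ(u⁺)φ(a) = φ(a)`
      have h1 := h.ip5 s (T.plus u) ⟨_, rfl⟩ (T.wo2 _ _ hus) u ⟨hus, rfl⟩
      have hp := h.map_proj (e := T.plus u) ⟨_, rfl⟩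
      rw [corestr_proj_comm hp ⟨_, rfl⟩, ← pseudo_proj hp] at h1
      have h2 : φ a ∈ T'.pseudo (φ (T.plus u)) (φ a) := by
        refine mem_pseudo.2 ⟨T'.plus (φ a), ?_, LiConstellation.plus_mul _⟩
        rw [corestr_proj_comm hp ⟨_, rfl⟩]
        refine proj_corestr ⟨_, rfl⟩ hp ?_
        rw [← hau]
        exact h.ip2 a
      obtain ⟨b, hb, hwb⟩ := LeftRestrictionSemigroupoid.assoc2 (S := T'.toSemigroupoid) h1 hw2
      rw [← Part.mem_unique h2 hb] at hwb
      exact hwb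
  pm2 s := le_of_toSemigroupoid_le.2 (h.ip2 s)

theorem id (T : LiConstellation.{u}) : IsInductivePreradiant T T _root_.id where
  ip1 x y a ha := by
    obtain ⟨w, h1, h2⟩ := (IsPremorphism.id T.toSemigroupoid).pm1 x y a (mem_pseudo_of_mul ha)
    exact ⟨w, h1, h2⟩
  ip2 x := T.le_refl _
  ip3 x y h := h
  ip4 x e he m hm := hm
  ip5 x e he hle r hr := by
    change T.plus r ∈ T.corestr e (T.plus x)
    rw [hr.2]
    exact proj_corestr he ⟨_, rfl⟩ hle

theorem comp {φ : T.carrier → T'.carrier} {ψ : T'.carrier → T''.carrier}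
    (hφ : IsInductivePreradiant T T' φ) (hψ : IsInductivePreradiant T' T'' ψ) :
    IsInductivePreradiant T T'' (ψ ∘ φ) where
  ip1 x y a ha := (hφ.isPremorphism.comp hψ.isPremorphism).pm1 x y a (mem_pseudo_of_mul ha)
  ip2 x := T''.le_trans _ _ _ (hψ.ip2 _) (hψ.ip3 _ _ (hφ.ip2 x))
  ip3 x y h := hψ.ip3 _ _ (hφ.ip3 _ _ h)
  ip4 x e he m hm := hψ.ip4 _ _ (hφ.map_proj he) _ (hφ.ip4 _ _ he _ hm)
  ip5 x e he hle r hr := by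
    have h1 := hφ.ip5 x e he hle r hr
    have hrx := hφ.ip3 _ _ hr.1
    have h2 := hψ.ip5 (φ x) (T'.plus (φ r)) ⟨_, rfl⟩ (T'.wo2 _ _ hrx) (φ r) ⟨hrx, rfl⟩
    have h3 := hψ.ip4 _ _ ⟨_, rfl⟩ _ h1
    have pe := hψ.map_proj (hφ.map_proj he)
    have px := hψ.map_proj (e := T'.plus (φ x)) ⟨_, rfl⟩
    have pr := hψ.map_proj (e := T'.plus (φ r)) ⟨_, rfl⟩
    have hx := hψ.ip2 (φ x)
    rw [mem_corestr_proj pr ⟨_, rfl⟩] at h2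
    rw [mem_corestr_proj pe px] at h3
    refine (mem_corestr_proj pe ⟨_, rfl⟩).2 ⟨h2.1, T''.le_trans _ _ _ h2.2.1 h3.2.1, h2.2.2.1, ?_⟩
    intro z hz h4 h5
    exact h2.2.2.2 z hz (h3.2.2.2 z hz h4 (T''.le_trans _ _ _ h5 hx)) h5

end IsInductivePreradiant

/-- The category of li-constellations and inductive preradiants, with the usual composition of
functions. -/
instance : Category LiConstellation.{u} where
  Hom T T' := {φ : T.carrier → T'.carrier // IsInductivePreradiant T T' φ}
  id T := ⟨id, IsInductivePreradiant.id T⟩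
  comp φ ψ := ⟨ψ.1 ∘ φ.1, φ.2.comp ψ.2⟩

/-! ## The constructions on objects -/

namespace LeftRestrictionSemigroupoid

variable {S : LeftRestrictionSemigroupoid.{u}}

/-- The partial operation `s • t`: it is defined iff `st⁺` is defined and equals `s`, and then
`s • t = st`. -/
def bullet (S : LeftRestrictionSemigroupoid.{u}) (s t : S.carrier) : Part S.carrier :=
  Part.assert (s ∈ S.mul s (S.plus t)) fun _ => S.mul s t

theorem mem_bullet {s t a : S.carrier} :
    a ∈ S.bullet s t ↔ s ∈ S.mul s (S.plus t) ∧ a ∈ S.mul s t := by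
  simp [bullet]

theorem bullet_dom {s t : S.carrier} :
    (S.bullet s t).Dom ↔ s ∈ S.mul s (S.plus t) := by
  constructor
  · intro h
    obtain ⟨a, ha⟩ := Part.dom_iff_mem.1 h
    exact (mem_bullet.1 ha).1
  · intro h
    obtain ⟨a, ha, -⟩ := mul_of_dom_plus h
    exact Part.dom_iff_mem.2 ⟨a, mem_bullet.2 ⟨h, ha⟩⟩

theorem plus_of_bullet {s t a : S.carrier} (h : a ∈ S.bullet s t) : S.plus a = S.plus s :=
  (plus_mul_plus (mem_bullet.1 h).2 (mem_bullet.1 h).1).symm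

/-- `(S, •, ⁺)` with the natural partial order. -/
abbrev toPosetConstellation (S : LeftRestrictionSemigroupoid.{u}) : PosetConstellation.{u} where
  carrier := S.carrier
  mul := S.bullet
  plus := S.plus
  le := S.le
  c1 x y z := by
    simp only [bullet_dom]
    constructor
    · rintro ⟨h1, h2⟩
      obtain ⟨b, hb⟩ := Part.dom_iff_mem.1 (bullet_dom.2 h2)
      refine ⟨b, hb, ?_⟩
      rw [plus_of_bullet hb]
      exact h1
    · rintro ⟨b, hb, h⟩
      rw [plus_of_bullet hb] at h
      exact ⟨h, (mem_bullet.1 hb).1⟩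
  c2 x y z h1 h2 := by
    obtain ⟨a, ha⟩ := Part.dom_iff_mem.1 h1
    obtain ⟨b, hb⟩ := Part.dom_iff_mem.1 h2
    refine ⟨a, ha, b, hb, ?_⟩
    have hb' := plus_of_bullet hb
    rw [bullet_dom] at h1 h2
    rw [mem_bullet] at ha hb
    obtain ⟨w, hw1, hw2⟩ := assoc1 ha.2 hb.2
    obtain ⟨v, hv1, hv2⟩ := assoc1 ha.2 h2
    have h3 := Part.mem_unique hv2 ha.2
    subst h3
    refine ⟨w, mem_bullet.2 ⟨?_, hw2⟩, mem_bullet.2 ⟨hv1, hw1⟩⟩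
    rw [hb']
    exact h1
  c3 := by
    rintro _ ⟨y, rfl⟩ x
    rw [mem_bullet]
    constructor
    · rintro ⟨h1, h2⟩
      exact Part.mem_unique h1 (S.lr3 _ _ _ h2)
    · intro h
      rw [h]
      exact ⟨plus_mul_self x, S.lr1 x⟩
  c4 := by
    rintro _ ⟨y, rfl⟩ x h
    have h1 := bullet_dom.1 h
    refine mem_bullet.2 ⟨h1, ?_⟩
    rwa [plus_plus] at h1
  le_refl := le_refl'
  le_trans _ _ _ := le_trans'
  le_antisymm _ _ := le_antisymm'

/-- The corestriction of `x` to `e ∈ S⁺` is `xe`. -/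
theorem corestr_eq (x y : S.carrier) :
    S.toPosetConstellation.corestr x (S.plus y) = S.mul x (S.plus y) := by
  have key : ∀ a, a ∈ S.mul x (S.plus y) →
      S.toPosetConstellation.IsCorestriction x (S.plus y) a := by
    intro a ha
    refine ⟨⟨mul_plus_le ha, bullet_dom.2 ?_⟩, ?_⟩
    · obtain ⟨w, h1, h2⟩ := assoc1 ha (plus_mul_self y)
      rw [plus_plus, Part.mem_unique ha h2]
      rwa [Part.mem_unique ha h2] at h1
    · intro z hz hd
      have hd' := bullet_dom.1 hd
      rw [plus_plus] at hd'
      obtain ⟨b, hb, h⟩ := assoc2 hz hd'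
      rw [← Part.mem_unique ha hb] at h
      exact h
  refine Part.ext fun m => ?_
  constructor
  · intro h
    have h1 := PosetConstellation.mem_corestr.1 h
    have h2 := bullet_dom.1 h1.1.2
    rw [plus_plus] at h2
    obtain ⟨b, hb, -⟩ := assoc2 h1.1.1 h2
    rwa [Part.mem_unique h (PosetConstellation.mem_corestr.2 (key b hb))]
  · intro h
    exact PosetConstellation.mem_corestr.2 (key m h)

theorem mem_corestr_iff {x y m : S.carrier} :
    m ∈ S.toPosetConstellation.corestr x (S.plus y) ↔ m ∈ S.mul x (S.plus y) :=
  Iff.of_eq (congrArg (fun p => m ∈ p) (corestr_eq x y))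

theorem corestr_dom_iff {x y : S.carrier} :
    (S.toPosetConstellation.corestr x (S.plus y)).Dom ↔ (S.mul x (S.plus y)).Dom := by
  rw [corestr_eq]

theorem mul_plus_dom_of_le {s e f : S.carrier} (h : S.le (S.plus f) (S.plus e)) :
    (S.mul s (S.plus e)).Dom ↔ (S.mul s (S.plus f)).Dom := by
  have h1 := le_plus_iff.1 h
  constructor
  · intro h2
    obtain ⟨a, ha⟩ := Part.dom_iff_mem.1 h2
    rw [S.lr2] at h1
    obtain ⟨w, -, hw⟩ := assoc1 ha h1
    exact Part.dom_iff_mem.2 ⟨w, hw⟩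
  · intro h2
    obtain ⟨a, ha⟩ := Part.dom_iff_mem.1 h2
    rw [S.lr2] at h1
    obtain ⟨b, hb, -⟩ := assoc3 h1 ha
    exact Part.dom_iff_mem.2 ⟨b, hb⟩

theorem meet_of_mul {e f m : S.carrier} (h : m ∈ S.mul (S.plus e) (S.plus f)) :
    S.plus m = m ∧ S.le m (S.plus e) ∧ S.le m (S.plus f) := by
  have h1 := S.lr3 _ _ _ h
  rw [plus_plus] at h1
  refine ⟨Part.mem_unique h1 h, mul_plus_le h, ?_⟩
  rw [S.lr2] at h
  exact mul_plus_le h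

theorem dom_of_eqvGen {e f : S.carrier} (he : e ∈ S.toPosetConstellation.proj)
    (h : Relation.EqvGen (fun a b => a ∈ S.toPosetConstellation.proj ∧
      b ∈ S.toPosetConstellation.proj ∧ S.le a b) e f) : (S.mul e f).Dom := by
  have key : ∀ a b, Relation.EqvGen (fun a b => a ∈ S.toPosetConstellation.proj ∧
      b ∈ S.toPosetConstellation.proj ∧ S.le a b) a b →
      ∀ s : S.carrier, (S.mul s a).Dom ↔ (S.mul s b).Dom := by
    intro a b hab
    induction hab with
    | rel x y hxy =>
      obtain ⟨⟨x, rfl⟩, ⟨y, rfl⟩, h⟩ := hxy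
      exact fun s => (mul_plus_dom_of_le h).symm
    | refl x => exact fun s => Iff.rfl
    | symm x y _ ih => exact fun s => (ih s).symm
    | trans x y z _ _ ih1 ih2 => exact fun s => (ih1 s).trans (ih2 s)
  rw [← key e f h e]
  obtain ⟨x, rfl⟩ := he
  exact Part.dom_iff_mem.2 ⟨_, plus_mul_self x⟩

theorem mem_component {e f m : S.carrier} (h : m ∈ S.mul (S.plus e) (S.plus f)) :
    m ∈ S.toPosetConstellation.component (S.plus e) ∧
      S.plus f ∈ S.toPosetConstellation.component (S.plus e) := by
  obtain ⟨h1, h2, h3⟩ := meet_of_mul h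
  have hm : m ∈ S.toPosetConstellation.proj := ⟨m, h1⟩
  have h4 : m ∈ S.toPosetConstellation.component (S.plus e) :=
    ⟨hm, .symm _ _ (.rel _ _ ⟨hm, ⟨e, rfl⟩, h2⟩)⟩
  exact ⟨h4, ⟨f, rfl⟩, .trans _ _ _ h4.2 (.rel _ _ ⟨hm, ⟨f, rfl⟩, h3⟩)⟩

theorem isMeetIn_of_mul {e f m : S.carrier} (h : m ∈ S.mul (S.plus e) (S.plus f)) :
    S.toPosetConstellation.IsMeetIn (S.toPosetConstellation.component (S.plus e))
      (S.plus e) (S.plus f) m := by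
  obtain ⟨h1, h2, h3⟩ := meet_of_mul h
  refine ⟨(mem_component h).1, h2, h3, ?_⟩
  rintro _ ⟨⟨z, rfl⟩, -⟩ hz1 hz2
  have hz3 := le_plus_iff.1 hz1
  have hz4 := le_plus_iff.1 hz2
  obtain ⟨b, hb, hz5⟩ := assoc2 hz3 hz4
  rw [← Part.mem_unique h hb] at hz5
  rw [← h1] at hz5 ⊢
  exact le_plus_iff.2 hz5

/-- The li-constellation `C(S)` of a left restriction semigroupoid `S`: the same set and the same
map `⁺`, with `s • t` as operation and the natural partial order of `S`. -/
abbrev toLiConstellation (S : LeftRestrictionSemigroupoid.{u}) : LiConstellation.{u} where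
  toPosetConstellation := S.toPosetConstellation
  wo1 x y x' y' h h' a ha b hb := by
    obtain ⟨h1, h2⟩ := mem_bullet.1 ha
    obtain ⟨h3, h4⟩ := mem_bullet.1 hb
    have hp := plus_of_bullet ha
    change a ∈ S.mul (S.plus a) b
    rw [hp]
    -- `x⁺(yy') = xy'`, and `xy' = (xx'⁺)y' = x(x'⁺y') = xx'`
    obtain ⟨w, hw1, hw2⟩ := assoc1 h h4
    obtain ⟨c, hc, hac⟩ := assoc3 h' h2
    rw [Part.mem_unique hc h1] at hac
    rw [Part.mem_unique hac hw1]
    exact hw2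
  wo2 x y := plus_mono
  wo3 := by
    rintro _ ⟨e, rfl⟩ x hle
    have h1 := le_plus_iff.1 hle
    obtain ⟨r, hr, -⟩ := mul_of_dom_plus h1
    have h2 := Part.mem_unique (S.lr3 _ _ _ hr) h1
    refine ⟨r, ⟨le_of_plus_mul hr, h2⟩, ?_⟩
    rintro y ⟨hy1, hy2⟩
    change y ∈ S.mul (S.plus y) x at hy1
    change S.plus y = S.plus e at hy2
    rw [hy2] at hy1
    exact Part.mem_unique hy1 hr
  wo4 := by
    rintro _ ⟨e, rfl⟩ x ⟨y, hy, hd⟩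
    refine corestr_dom_iff.2 ?_
    have hd' := bullet_dom.1 hd
    rw [plus_plus] at hd'
    obtain ⟨b, hb, -⟩ := assoc2 hy hd'
    exact Part.dom_iff_mem.2 ⟨b, hb⟩
  wo5 := by
    rintro _ ⟨e, rfl⟩ x y a ha
    refine corestr_dom_iff.trans (Iff.trans ?_ corestr_dom_iff.symm)
    have ha' := (mem_bullet.1 ha).2
    constructor
    · intro h
      obtain ⟨w, hw⟩ := Part.dom_iff_mem.1 h
      obtain ⟨b, hb, -⟩ := assoc2 ha' hw
      exact Part.dom_iff_mem.2 ⟨b, hb⟩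
    · intro h
      obtain ⟨b, hb⟩ := Part.dom_iff_mem.1 h
      obtain ⟨w, hw, -⟩ := assoc1 ha' hb
      exact Part.dom_iff_mem.2 ⟨w, hw⟩
  wo6 := by
    rintro _ ⟨e, rfl⟩ _ ⟨f, rfl⟩ hle x
    exact corestr_dom_iff.trans ((mul_plus_dom_of_le hle).trans corestr_dom_iff.symm)
  wo7 := by
    rintro _ ⟨e, rfl⟩ x y a ha m hm
    replace hm := mem_corestr_iff.1 hm
    obtain ⟨n, hn, hmn⟩ := assoc2 (mem_bullet.1 ha).2 hm
    obtain ⟨k, hk, -⟩ := dom_plus hmn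
    exact ⟨n, mem_corestr_iff.2 hn, k, mem_corestr_iff.2 hk, (plus_mul_plus hmn hk).symm⟩
  wo8 := by
    rintro _ ⟨e, rfl⟩ _ ⟨f, rfl⟩ hle
    exact ⟨S.plus e, ⟨hle, plus_plus e⟩, mem_corestr_iff.2 (le_plus_iff.1 hle)⟩
  wo9_meet := by
    rintro _ ⟨e, rfl⟩ _ ⟨⟨f, rfl⟩, hf⟩
    obtain ⟨m, hm⟩ := Part.dom_iff_mem.1 (dom_of_eqvGen ⟨e, rfl⟩ hf)
    exact ⟨m, isMeetIn_of_mul hm⟩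
  wo9_corestr := by
    rintro _ ⟨e, rfl⟩ _ ⟨f, rfl⟩ m
    refine mem_corestr_iff.trans ?_
    constructor
    · intro h
      exact ⟨(mem_component h).2, isMeetIn_of_mul h⟩
    · rintro ⟨⟨-, hf⟩, h1, h2, h3, h4⟩
      obtain ⟨m', hm'⟩ := Part.dom_iff_mem.1 (dom_of_eqvGen ⟨e, rfl⟩ hf)
      have h5 := isMeetIn_of_mul hm'
      have h6 := le_antisymm' (h5.2.2.2 m h1 h2 h3) (h4 m' h5.1 h5.2.1 h5.2.2.1)
      subst h6
      exact hm'

end LeftRestrictionSemigroupoid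

/-! The two structures live on one set with one map `⁺`, and each operation determines the other.

From `S` to `C(S)` and back: in `C(S)` the corestriction `x|y⁺` is the product `xy⁺` (`corestr_eq`),
so the pseudo-product is `(xy⁺)y = x(y⁺y) = xy`, with the same domain as the product of `S`. This is
`pseudo_toPosetConstellation`.

From `T` to `G(T)` and back: `x ⊗ y⁺ = x|y⁺`. This element equals `x` exactly when `xy⁺` is defined,
which means exactly when `xy` is defined, and then `x ⊗ y = (x|y⁺)y = xy`. So restricting `⊗` to the
pairs with `x ⊗ y⁺ = x` returns the product of `T` (`bullet_toSemigroupoid`). The order returns as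
well, because `x ≤ y` holds in `T` iff `x = x⁺ ⊗ y` (`le_of_toSemigroupoid_le`).

On morphisms, one and the same function is a premorphism iff it is an inductive preradiant. One half
is `IsInductivePreradiant.isPremorphism`. The other is `IsPremorphism.isInductivePreradiant`: the
premorphism law applied to `xe` and to `r = r⁺x` gives conditions (iv) and (v), once the extra left
factor is absorbed by an order comparison. Both functors therefore keep underlying functions, and
the equalities on objects carry over to morphisms. -/

/-! ### Recovering a left restriction semigroupoid from its constellation -/

namespace LeftRestrictionSemigroupoid

variable {S : LeftRestrictionSemigroupoid.{u}}

/-- Left multiplication by `t⁺` fixes every element `s` with `s⁺ ≤ t⁺`. -/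
theorem mem_plus_mul_of_plus_le {s t : S.carrier} (h : S.le (S.plus s) (S.plus t)) :
    s ∈ S.mul (S.plus t) s := by
  have h1 := le_plus_iff.1 h
  rw [S.lr2] at h1
  obtain ⟨b, hb, hs⟩ := assoc2 h1 (S.lr1 s)
  rwa [← Part.mem_unique (S.lr1 s) hb] at hs

/-- The pseudo-product of `C(S)` is the product of `S`. -/
theorem pseudo_toPosetConstellation (S : LeftRestrictionSemigroupoid.{u}) :
    S.toPosetConstellation.pseudo = S.mul := by
  funext x y
  refine Part.ext fun z => PosetConstellation.mem_pseudo.trans ⟨?_, fun hz => ?_⟩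
  · rintro ⟨m, hm, hz⟩
    -- Here `m = xy⁺` and `z = my`, so `z = x(y⁺y)`, and `y⁺y = y`.
    obtain ⟨b, hb, hzb⟩ := assoc2 (mem_corestr_iff.1 hm) (mem_bullet.1 hz).2
    rwa [← Part.mem_unique (S.lr1 y) hb] at hzb
  · obtain ⟨m, hm, hz⟩ := dom_plus hz
    have hm' := mem_corestr_iff.2 hm
    -- `m • y` must be defined, that is, `my⁺ = m`. A corestriction to `y⁺` composes with `y⁺` under
    -- `•`, which says the same with `y⁺⁺` in place of `y⁺`.
    have hd := bullet_dom.1 (PosetConstellation.mem_corestr.1 hm').1.2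
    rw [plus_plus] at hd
    exact ⟨m, hm', mem_bullet.2 ⟨hd, hz⟩⟩

/-- `G(C(S)) = S`. -/
theorem toSemigroupoid_toLiConstellation (S : LeftRestrictionSemigroupoid.{u}) :
    S.toLiConstellation.toSemigroupoid = S := by
  have h := pseudo_toPosetConstellation S
  -- Once `S` is split into its fields, the carriers and the maps `⁺` agree definitionally and the
  -- axioms are proofs, so only the equality of the two operations is left.
  rcases S with ⟨⟨X, mul, assoc⟩, plus, lr1, lr2, lr3, lr4⟩
  simp only [LiConstellation.toSemigroupoid, LeftRestrictionSemigroupoid.mk.injEq,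
    Semigroupoid.mk.injEq, heq_eq_eq, true_and, and_true]
  exact h

end LeftRestrictionSemigroupoid

/-! ### Recovering an li-constellation from its semigroupoid -/

namespace LiConstellation

/-- The operation `•` of `G(T)` is the product of `T`. -/
theorem bullet_toSemigroupoid (T : LiConstellation.{u}) : T.toSemigroupoid.bullet = T.mul := by
  funext x y
  refine Part.ext fun a => LeftRestrictionSemigroupoid.mem_bullet.trans ⟨?_, fun ha => ?_⟩
  · rintro ⟨hx, ha⟩
    change x ∈ T.pseudo x (T.plus y) at hx
    -- The condition `x ⊗ y⁺ = x` becomes `x|y⁺ = x`, so the factor `m` in `x ⊗ y = my` is `x`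
    -- itself.
    rw [pseudo_proj ⟨_, rfl⟩] at hx
    obtain ⟨m, hm, ham⟩ := PosetConstellation.mem_pseudo.1 ha
    rwa [Part.mem_unique hm hx] at ham
  · refine ⟨?_, mem_pseudo_of_mul ha⟩
    change x ∈ T.pseudo x (T.plus y)
    rw [pseudo_proj ⟨_, rfl⟩]
    exact corestr_self_of_mul ha

/-- `C(G(T)) = T`. -/
theorem toLiConstellation_toSemigroupoid (T : LiConstellation.{u}) :
    T.toSemigroupoid.toLiConstellation = T := by
  have h := bullet_toSemigroupoid T
  -- Unlike a semigroupoid, a constellation carries its order as data, so the orders have to be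
  -- compared as well as the operations.
  have hle : T.toSemigroupoid.le = T.le :=
    funext fun _ => funext fun _ => propext le_of_toSemigroupoid_le
  rcases T with ⟨⟨⟨X, mul, plus, c1, c2, c3, c4⟩, le, _, _, _⟩, _, _, _, _, _, _, _, _, _, _⟩
  simp only [LeftRestrictionSemigroupoid.toLiConstellation,
    LeftRestrictionSemigroupoid.toPosetConstellation, LiConstellation.mk.injEq,
    PosetConstellation.mk.injEq, LeftConstellation.mk.injEq, heq_eq_eq, true_and, and_true]
  exact ⟨h, hle⟩

end LiConstellation

/-! ### Morphisms and the two functors -/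

/-- A premorphism `S → S'` is an inductive preradiant `C(S) → C(S')`. -/
theorem IsPremorphism.isInductivePreradiant {S S' : LeftRestrictionSemigroupoid.{u}}
    {φ : S.carrier → S'.carrier} (h : IsPremorphism S S' φ) :
    IsInductivePreradiant S.toLiConstellation S'.toLiConstellation φ where
  ip1 x y a ha := by
    change ∃ w, w ∈ S'.toPosetConstellation.pseudo (φ x) (φ y) ∧
      w ∈ S'.toPosetConstellation.pseudo (S'.plus (φ x)) (φ a)
    rw [LeftRestrictionSemigroupoid.pseudo_toPosetConstellation]
    exact h.pm1 x y a (LeftRestrictionSemigroupoid.mem_bullet.1 ha).2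
  ip2 := h.pm2
  ip3 _ _ := h.mono
  ip4 := by
    rintro x _ ⟨e, rfl⟩ m hm
    have hm' := LeftRestrictionSemigroupoid.mem_corestr_iff.1 hm
    obtain ⟨w, h1, h2⟩ := h.pm1 _ _ _ hm'
    -- With `m = xe⁺`, the premorphism law gives `φ(x)φ(e⁺) = φ(x)⁺φ(m)`. Since `m ≤ x`,
    -- monotonicity gives `φ(m)⁺ ≤ φ(x)⁺`, so the right-hand side is `φ(m)`.
    have h3 := LeftRestrictionSemigroupoid.mem_plus_mul_of_plus_le
      (LeftRestrictionSemigroupoid.plus_mono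
        (h.mono (LeftRestrictionSemigroupoid.mul_plus_le hm')))
    change φ m ∈ S'.toPosetConstellation.corestr (φ x) (φ (S.plus e))
    -- `φ(e⁺)` is rewritten as `φ(e⁺)⁺` because corestriction is identified with multiplication only
    -- for elements displayed as some `y⁺`.
    rw [← h.map_plus e, LeftRestrictionSemigroupoid.mem_corestr_iff, h.map_plus,
      Part.mem_unique h3 h2]
    exact h1
  ip5 := by
    rintro x _ ⟨e, rfl⟩ - r ⟨hr, hre⟩
    change r ∈ S.mul (S.plus r) x at hr
    change S.plus r = S.plus e at hre
    obtain ⟨w, h1, h2⟩ := h.pm1 _ _ _ hr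
    -- As `r = r⁺x`, the premorphism law gives `φ(r⁺)φ(x) = φ(r⁺)⁺φ(r)`. This inequality reduces the
    -- right-hand side to `φ(r)`.
    have hle : S'.le (S'.plus (φ r)) (S'.plus (φ (S.plus r))) := by
      rw [h.map_plus]
      exact h.pm2 r
    rw [← Part.mem_unique (LeftRestrictionSemigroupoid.mem_plus_mul_of_plus_le hle) h2,
      ← h.map_plus] at h1
    change S'.plus (φ r) ∈ S'.toPosetConstellation.corestr (φ (S.plus e)) (S'.plus (φ x))
    rw [LeftRestrictionSemigroupoid.mem_corestr_iff, ← hre, ← h.map_plus]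
    -- From `φ(r) = φ(r⁺)φ(x)`, where `φ(r⁺)` is a projection, axiom (3) yields `φ(r)⁺ =
    -- φ(r⁺)φ(x)⁺`.
    exact S'.lr3 _ _ _ h1

/-- The functor `C`, acting identically on underlying functions. -/
def LeftRestrictionSemigroupoid.constellationFunctor :
    LeftRestrictionSemigroupoid.{u} ⥤ LiConstellation.{u} where
  obj S := S.toLiConstellation
  map φ := ⟨φ.1, φ.2.isInductivePreradiant⟩

/-- The functor `G`, acting identically on underlying functions. -/
noncomputable def LiConstellation.semigroupoidFunctor :
    LiConstellation.{u} ⥤ LeftRestrictionSemigroupoid.{u} where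
  obj T := T.toSemigroupoid
  map φ := ⟨φ.1, φ.2.isPremorphism⟩

/-! ### Equality of the composite functors with the identities -/

/-- `G(C(S)) = S` is a propositional equality, so a morphism and its image under `C ⋙ G` lie in
different hom types. After substituting the object equalities, a morphism is determined by its
underlying function. -/
theorem LeftRestrictionSemigroupoid.hom_heq {A A' B B' : LeftRestrictionSemigroupoid.{u}}
    (hA : A = A') (hB : B = B') {φ : A ⟶ B} {ψ : A' ⟶ B'} (h : HEq φ.1 ψ.1) : HEq φ ψ := by
  subst hA hB
  exact heq_of_eq (Subtype.ext (eq_of_heq h))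

theorem LiConstellation.hom_heq {A A' B B' : LiConstellation.{u}}
    (hA : A = A') (hB : B = B') {φ : A ⟶ B} {ψ : A' ⟶ B'} (h : HEq φ.1 ψ.1) : HEq φ ψ := by
  subst hA hB
  exact heq_of_eq (Subtype.ext (eq_of_heq h))

/-- The clauses on morphisms use `HEq` because `C` and `G` are bound existentially: the carriers of
`C.obj S` and `G.obj T` are known only through the preceding equations. -/
theorem mainTheorem2 :
    ∃ (C : LeftRestrictionSemigroupoid.{u} ⥤ LiConstellation.{u})
      (G : LiConstellation.{u} ⥤ LeftRestrictionSemigroupoid.{u}),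
      (∀ S, C.obj S = S.toLiConstellation) ∧
      (∀ T, G.obj T = T.toSemigroupoid) ∧
      (∀ (S S' : LeftRestrictionSemigroupoid.{u}) (φ : S ⟶ S'), HEq (C.map φ).1 φ.1) ∧
      (∀ (T T' : LiConstellation.{u}) (φ : T ⟶ T'), HEq (G.map φ).1 φ.1) ∧
      C ⋙ G = 𝟭 LeftRestrictionSemigroupoid.{u} ∧
      G ⋙ C = 𝟭 LiConstellation.{u} := by
  refine ⟨LeftRestrictionSemigroupoid.constellationFunctor, LiConstellation.semigroupoidFunctor,
    fun _ => rfl, fun _ => rfl, fun _ _ _ => HEq.rfl, fun _ _ _ => HEq.rfl, ?_, ?_⟩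
  · exact Functor.hext LeftRestrictionSemigroupoid.toSemigroupoid_toLiConstellation
      -- The round trip leaves the carrier definitionally unchanged, so the two underlying functions
      -- are literally the same and `HEq.rfl` applies.
      fun S S' _ => LeftRestrictionSemigroupoid.hom_heq S.toSemigroupoid_toLiConstellation
        S'.toSemigroupoid_toLiConstellation HEq.rfl
  · exact Functor.hext LiConstellation.toLiConstellation_toSemigroupoid
      fun T T' _ => LiConstellation.hom_heq T.toLiConstellation_toSemigroupoid
        T'.toLiConstellation_toSemigroupoid HEq.rfl
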